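/- Let $L$ be a finite-dimensional (left) Leibniz algebra over an arbitrary field $F$, i.e. a finite-dimensional $F$-vector space with a bilinear product satisfying $a(bc)=(ab)c+b(ac)$. Let $K$ be the algebraic closure of $F$. A subalgebra $S$ of $L$ is called triangulable on $L$ if $K\otimes_F L$ has a $K$-basis with respect to which all elements of $K\otimes_F S$ act on $K\otimes_F L$, by left and by right multiplication, through upper triangular matrices. Let $\phi(L)$ be the Frattini ideal of $L$, i.e. the largest two-sided ideal of $L$ contained in the intersection of all maximal subalgebras of $L$. **Theorem.** Suppose that $L$ is minimally non-triangulable: every proper subalgebra of $L$ is triangulable on $L$, but $L$ is not triangulable on $L$. Then $L$ is two-generated (there are $x,y\in L$ such that the subalgebra generated by $x$ and $y$ is $L$), and $L/\phi(L)$ is simple (its product is not identically zero and its only two-sided ideals are $0$ and $L/\phi(L)$). -/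

import Mathlib

open scoped TensorProduct

universe u v

/-- The (left) Leibniz identity `a(bc) = (ab)c + b(ac)` for a bilinear multiplication. -/
class IsLeibniz (L : Type v) [NonUnitalNonAssocRing L] : Prop where
  leibniz : ∀ a b c : L, a * (b * c) = (a * b) * c + b * (a * c)

/-- A two-sided ideal of an `F`-algebra (a linear subspace stable under left and right
multiplication by arbitrary elements). -/
@[ext]
structure LeibnizIdeal (F : Type u) (L : Type v) [Field F] [NonUnitalNonAssocRing L]
    [Module F L] extends Submodule F L where
  mul_mem_left : ∀ (x : L) {y : L}, y ∈ carrier → x * y ∈ carrier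
  mul_mem_right : ∀ (x : L) {y : L}, y ∈ carrier → y * x ∈ carrier

namespace LeibnizIdeal

variable {F : Type u} {L : Type v} [Field F] [NonUnitalNonAssocRing L] [Module F L]

/-- The quotient algebra `L / I`. -/
abbrev Quotient (I : LeibnizIdeal F L) : Type v := L ⧸ I.toSubmodule

instance (I : LeibnizIdeal F L) : Mul I.Quotient where
  mul := Quotient.map₂ (· * ·) (by
    intro a a' ha b b' hb
    have ha' : a - a' ∈ I.toSubmodule := (Submodule.quotientRel_def _).1 ha
    have hb' : b - b' ∈ I.toSubmodule := (Submodule.quotientRel_def _).1 hb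
    refine (Submodule.quotientRel_def _).2 ?_
    have h : a * b - a' * b' = (a - a') * b + a' * (b - b') := by
      rw [sub_mul, mul_sub]; abel
    rw [h]
    exact I.toSubmodule.add_mem (I.mul_mem_right b ha') (I.mul_mem_left a' hb'))

theorem Quotient.mk_mul (I : LeibnizIdeal F L) (a b : L) :
    (Submodule.Quotient.mk (a * b) : I.Quotient)
      = Submodule.Quotient.mk a * Submodule.Quotient.mk b := rfl

instance (I : LeibnizIdeal F L) : NonUnitalNonAssocRing I.Quotient where
  left_distrib := by
    rintro ⟨a⟩ ⟨b⟩ ⟨c⟩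
    exact congrArg (Submodule.Quotient.mk (p := I.toSubmodule)) (mul_add a b c)
  right_distrib := by
    rintro ⟨a⟩ ⟨b⟩ ⟨c⟩
    exact congrArg (Submodule.Quotient.mk (p := I.toSubmodule)) (add_mul a b c)
  zero_mul := by
    rintro ⟨a⟩
    exact congrArg (Submodule.Quotient.mk (p := I.toSubmodule)) (zero_mul a)
  mul_zero := by
    rintro ⟨a⟩
    exact congrArg (Submodule.Quotient.mk (p := I.toSubmodule)) (mul_zero a)

instance (I : LeibnizIdeal F L) [IsScalarTower F L L] :
    IsScalarTower F I.Quotient I.Quotient where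
  smul_assoc := by
    rintro r ⟨a⟩ ⟨b⟩
    exact congrArg (Submodule.Quotient.mk (p := I.toSubmodule)) (smul_assoc r a b)

instance (I : LeibnizIdeal F L) [SMulCommClass F L L] :
    SMulCommClass F I.Quotient I.Quotient where
  smul_comm := by
    rintro r ⟨a⟩ ⟨b⟩
    exact congrArg (Submodule.Quotient.mk (p := I.toSubmodule)) (smul_comm r a b)

instance (I : LeibnizIdeal F L) [IsLeibniz L] : IsLeibniz I.Quotient where
  leibniz := by
    rintro ⟨a⟩ ⟨b⟩ ⟨c⟩
    exact congrArg (Submodule.Quotient.mk (p := I.toSubmodule)) (IsLeibniz.leibniz a b c)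

end LeibnizIdeal

section

variable (F : Type u) (L : Type v) [Field F] [NonUnitalNonAssocRing L] [Module F L]

/-- A simple algebra: its multiplication is not identically zero, and it has no two-sided ideals
other than `0` and itself. -/
def IsSimpleLeibniz : Prop :=
  (∃ x y : L, x * y ≠ 0) ∧
    ∀ I : LeibnizIdeal F L, I.toSubmodule = ⊥ ∨ I.toSubmodule = ⊤

variable [IsScalarTower F L L] [SMulCommClass F L L]

/-- The Frattini subalgebra: the intersection of all maximal subalgebras. -/
def frattiniSubalgebra : NonUnitalSubalgebra F L :=
  sInf {M : NonUnitalSubalgebra F L | IsCoatom M}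

/-- The Frattini ideal: the largest two-sided ideal contained in the Frattini subalgebra, that is,
the sum of all ideals contained in it (see `frattiniIdeal_isGreatest`). -/
def frattiniIdeal : LeibnizIdeal F L where
  toSubmodule := ⨆ I : {I : LeibnizIdeal F L //
    I.toSubmodule ≤ (frattiniSubalgebra F L).toSubmodule}, I.1.toSubmodule
  mul_mem_left := by
    intro x y hy
    refine Submodule.iSup_induction (motive := fun y => x * y ∈ (⨆ I : {I : LeibnizIdeal F L //
      I.toSubmodule ≤ (frattiniSubalgebra F L).toSubmodule}, I.1.toSubmodule)) _ hy ?_ ?_ ?_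
    · intro I z hz
      exact Submodule.mem_iSup_of_mem I (I.1.mul_mem_left x hz)
    · rw [mul_zero]; exact Submodule.zero_mem _
    · intro a b ha hb
      rw [mul_add]; exact Submodule.add_mem _ ha hb
  mul_mem_right := by
    intro x y hy
    refine Submodule.iSup_induction (motive := fun y => y * x ∈ (⨆ I : {I : LeibnizIdeal F L //
      I.toSubmodule ≤ (frattiniSubalgebra F L).toSubmodule}, I.1.toSubmodule)) _ hy ?_ ?_ ?_
    · intro I z hz
      exact Submodule.mem_iSup_of_mem I (I.1.mul_mem_right x hz)
    · rw [zero_mul]; exact Submodule.zero_mem _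
    · intro a b ha hb
      rw [add_mul]; exact Submodule.add_mem _ ha hb

theorem frattiniIdeal_isGreatest :
    (frattiniIdeal F L).toSubmodule ≤ (frattiniSubalgebra F L).toSubmodule ∧
      ∀ I : LeibnizIdeal F L, I.toSubmodule ≤ (frattiniSubalgebra F L).toSubmodule →
        I.toSubmodule ≤ (frattiniIdeal F L).toSubmodule :=
  ⟨iSup_le fun I => I.2, fun I hI =>
    le_iSup (fun I : {I : LeibnizIdeal F L //
      I.toSubmodule ≤ (frattiniSubalgebra F L).toSubmodule} => I.1.toSubmodule) ⟨I, hI⟩⟩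

variable {F L}

/-- A subalgebra `S` is triangulable on the ambient algebra `L` if, for `K` the algebraic closure
of `F`, the space `K ⊗ L` has a `K`-basis in which all elements of `K ⊗ S` (viewed inside `K ⊗ L`)
act, by left and by right multiplication, through upper triangular matrices. -/
def IsTriangulableOn (S : NonUnitalSubalgebra F L) : Prop :=
  ∃ (n : ℕ) (b : Module.Basis (Fin n) (AlgebraicClosure F) (AlgebraicClosure F ⊗[F] L)),
    ∀ z ∈ S.toSubmodule.baseChange (AlgebraicClosure F),
      (LinearMap.toMatrix b b (LinearMap.mulLeft (AlgebraicClosure F) z)).BlockTriangular id ∧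
      (LinearMap.toMatrix b b (LinearMap.mulRight (AlgebraicClosure F) z)).BlockTriangular id

variable (F L)

/-- `L` can be generated, as an algebra, by two elements. -/
def IsTwoGenerated : Prop :=
  ∃ x y : L, NonUnitalAlgebra.adjoin F ({x, y} : Set L) = ⊤

/-- Every proper subalgebra of `L` is triangulable on `L`, but `L` itself is not. -/
def IsMinimallyNonTriangulable : Prop :=
  (∀ S : NonUnitalSubalgebra F L, S ≠ ⊤ → IsTriangulableOn S) ∧
    ¬ IsTriangulableOn (⊤ : NonUnitalSubalgebra F L)

end

/-! Triangulability is read off from pairs: a subalgebra `S` is triangulable on `L` iff left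
multiplication by `a * b` is nilpotent for all `a, b ∈ S` (`isTriangulableOn_iff`). One direction
holds because `mulLeft (a * b)` is a commutator. The other combines Jacobson's theorem on weakly
closed sets with a common eigenvector argument over the algebraic closure. Since the criterion sees
two elements at a time, a non-triangulable algebra whose proper subalgebras are triangulable must be
generated by two elements.

For simplicity of the quotient, the two key facts are that triangulable subalgebras are solvable
(`exists_derived_eq_bot`) and that `L` is perfect (`square_top_eq_top`). If `L²` were proper, `L`
would be solvable, and a Fitting argument along the derived series (`exists_pow_mem_derived`) would
make every product act nilpotently, so `L` would be triangulable. Now let `I` be a proper ideal and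
`M` a maximal subalgebra not containing `I`. Then `L = M + I`, so `L / I` is both perfect and an
image of the solvable `M`, forcing `I = L`. Hence every proper ideal lies in all maximal
subalgebras, that is, in the Frattini ideal. -/

/-! ### Jacobson's theorem on weakly closed sets of nilpotent elements. -/

section Nil

variable {F A : Type*} [Field F] [Ring A] [Algebra F A]

/-- Iterated brackets with a nilpotent subspace: the subspaces `Z₀ = A`, `Zₖ₊₁ = P Zₖ + Zₖ P`. -/
def bracketFiltration (P : Submodule F A) : ℕ → Submodule F A
  | 0 => ⊤
  | k + 1 => P * bracketFiltration P k ⊔ bracketFiltration P k * P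

/-- Expanding `Zₖ` into terms `P ^ i * ⊤ * P ^ j` with `i + j = k` leaves at least `2 * n` factors
`P` around `⊤`, so one side carries at least `n` of them. -/
theorem pow_mul_bracketFiltration_mul_pow {P : Submodule F A} {n : ℕ} (hP : P ^ n = 0) (k : ℕ) :
    ∀ a b : ℕ, 2 * n ≤ a + b + k → P ^ a * bracketFiltration P k * P ^ b = 0 := by
  induction k with
  | zero =>
    intro a b h
    rcases (by omega : n ≤ a ∨ n ≤ b) with h' | h'
    · rw [pow_eq_zero_of_le h' hP, zero_mul, zero_mul]
    · rw [pow_eq_zero_of_le h' hP, mul_zero]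
  | succ k ih =>
    intro a b h
    have h1 := ih (a + 1) b (by omega)
    have h2 := ih a (b + 1) (by omega)
    rw [bracketFiltration, ← Submodule.add_eq_sup, mul_add, add_mul, ← mul_assoc (P ^ a) P,
      ← pow_succ, h1, zero_add, ← mul_assoc, mul_assoc _ P, ← pow_succ', h2]

theorem bracketFiltration_eq_zero {P : Submodule F A} {n : ℕ} (hP : P ^ n = 0) :
    bracketFiltration P (2 * n) = 0 := by
  simpa using pow_mul_bracketFiltration_mul_pow hP (2 * n) 0 0 (by omega)

/-- Otherwise, bracketing repeatedly with elements of `W ∩ P` never leaves `W` nor enters `P`. The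
`k`-th bracket lies in `Zₖ`, which vanishes for `k = 2 * n`, while `0 ∈ P`. -/
theorem exists_bracket_mem_of_isNilpotent {W : Set A}
    (hW : ∀ a ∈ W, ∀ b ∈ W, a * b - b * a ∈ W)
    {P : Submodule F A} (hP : IsNilpotent P) (hWP : ¬ W ⊆ P) :
    ∃ w ∈ W, w ∉ P ∧ ∀ u ∈ W, u ∈ P → u * w - w * u ∈ P := by
  by_contra! hcon
  obtain ⟨n, hn⟩ := hP
  have key : ∀ k, ∃ w ∈ W, w ∉ P ∧ w ∈ bracketFiltration P k := by
    intro k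
    induction k with
    | zero =>
      obtain ⟨w, hw, hwP⟩ := Set.not_subset.1 hWP
      exact ⟨w, hw, hwP, Submodule.mem_top⟩
    | succ k ih =>
      obtain ⟨w, hw, hwP, hk⟩ := ih
      obtain ⟨u, hu, huP, hb⟩ := hcon w hw hwP
      exact ⟨_, hW u hu w hw, hb, sub_mem
        (Submodule.mem_sup_left (Submodule.mul_mem_mul huP hk))
        (Submodule.mem_sup_right (Submodule.mul_mem_mul hk huP))⟩
  obtain ⟨w, -, hwP, hw⟩ := key (2 * n)
  rw [bracketFiltration_eq_zero hn] at hw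
  rw [(Submodule.mem_bot F).1 hw] at hwP
  exact hwP P.zero_mem

/-- The hypothesis on `T * P` makes each right ideal `P ^ k * ⊤` stable under `T`. Modulo `P ^ (k +
1) * ⊤`, the summand `P` acts on it as zero, so `P + T` acts as `T` does; thus `m` factors `P + T`
move one step down the filtration. -/
theorem isNilpotent_add_of_mul_le {P T : Submodule F A} {n m : ℕ} (hn : P ^ n = 0)
    (hTm : T ^ m = 0) (hTP : T * P ≤ P * T + P) : IsNilpotent (P + T) := by
  have hTR : ∀ k, T * (P ^ k * ⊤) ≤ P ^ k * ⊤ := by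
    intro k
    induction k with
    | zero => simp
    | succ k ih =>
      calc T * (P ^ (k + 1) * ⊤) = (T * P) * (P ^ k * ⊤) := by
            rw [pow_succ']; simp only [mul_assoc]
        _ ≤ (P * T + P) * (P ^ k * ⊤) := mul_le_mul_left hTP _
        _ = P * (T * (P ^ k * ⊤)) + P * (P ^ k * ⊤) := by rw [add_mul, mul_assoc]
        _ ≤ P * (P ^ k * ⊤) + P * (P ^ k * ⊤) := add_le_add_left (mul_le_mul_right ih _) _
        _ = P ^ (k + 1) * ⊤ := by
            rw [Submodule.add_eq_sup, sup_idem, pow_succ', mul_assoc]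
  have hTjR : ∀ j k, T ^ j * (P ^ k * ⊤) ≤ P ^ k * ⊤ := by
    intro j k
    induction j with
    | zero => simp
    | succ j ih => rw [pow_succ', mul_assoc]; exact (mul_le_mul_right ih _).trans (hTR k)
  have hPR : ∀ k, P * (P ^ k * ⊤) = P ^ (k + 1) * ⊤ := fun k => by rw [pow_succ', mul_assoc]
  have hPR' : ∀ k, P ^ (k + 1) * ⊤ ≤ P ^ k * (⊤ : Submodule F A) := fun k => by
    rw [pow_succ, mul_assoc]; exact mul_le_mul_right le_top _
  have hQ : ∀ k j, (P + T) ^ j * (P ^ k * ⊤) ≤ T ^ j * (P ^ k * ⊤) + P ^ (k + 1) * ⊤ := by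
    intro k j
    induction j with
    | zero => simp [Submodule.add_eq_sup]
    | succ j ih =>
      rw [pow_succ', mul_assoc]
      refine (mul_le_mul_right ih _).trans ?_
      rw [mul_add, add_mul, add_mul, ← mul_assoc T, ← pow_succ']
      simp only [Submodule.add_eq_sup]
      refine sup_le (sup_le ?_ le_sup_left) (sup_le ?_ ?_)
      · exact ((mul_le_mul_right (hTjR j k) _).trans (hPR k).le).trans le_sup_right
      · exact ((hPR _).le.trans (hPR' _)).trans le_sup_right
      · exact (hTR _).trans le_sup_right
  have hfin : ∀ k, (P + T) ^ (m * k) * ⊤ ≤ P ^ k * ⊤ := by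
    intro k
    induction k with
    | zero => simp
    | succ k ih =>
      rw [Nat.mul_succ, add_comm (m * k), pow_add, mul_assoc]
      refine (mul_le_mul_right ih _).trans ((hQ k m).trans ?_)
      rw [hTm, zero_mul, zero_add]
  refine ⟨m * n, ?_⟩
  have h1 := hfin n
  rw [hn, zero_mul] at h1
  have h2 : (P + T) ^ (m * n) * 1 ≤ (P + T) ^ (m * n) * ⊤ := mul_le_mul_right le_top _
  rw [mul_one] at h2
  exact le_antisymm (h2.trans h1) bot_le

theorem isNilpotent_sup_span_singleton {P : Submodule F A} {w : A} (hP : IsNilpotent P)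
    (hw : IsNilpotent w) (hPw : ∀ u ∈ P, u * w - w * u ∈ P) :
    IsNilpotent (P ⊔ Submodule.span F {w}) := by
  obtain ⟨n, hn⟩ := hP
  obtain ⟨m, hm⟩ := hw
  rw [← Submodule.add_eq_sup]
  refine isNilpotent_add_of_mul_le hn (m := m) ?_ ?_
  · rw [Submodule.span_pow, Set.singleton_pow, hm]
    exact Submodule.span_singleton_eq_bot.2 rfl
  · rw [Submodule.mul_le]
    intro a ha p hp
    obtain ⟨c, rfl⟩ := Submodule.mem_span_singleton.1 ha
    have h1 : c • w * p = c • (p * w - (p * w - w * p)) := by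
      rw [smul_mul_assoc, sub_sub_cancel]
    rw [h1, Submodule.add_eq_sup]
    exact Submodule.smul_mem _ _ (sub_mem (Submodule.mem_sup_left
      (Submodule.mul_mem_mul hp (Submodule.mem_span_singleton_self w)))
      (Submodule.mem_sup_right (hPw p hp)))

/-- Jacobson's theorem on weakly closed sets: a set of nilpotent elements of a finite-dimensional
associative algebra which is closed under commutators spans a nilpotent subspace. -/
theorem isNilpotent_span_of_forall_commutator_mem [FiniteDimensional F A] {W : Set A}
    (hW : ∀ a ∈ W, ∀ b ∈ W, a * b - b * a ∈ W) (hnil : ∀ a ∈ W, IsNilpotent a) :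
    IsNilpotent (Submodule.span F W) := by
  have hbr : ∀ {P : Submodule F A} {w : A}, P ≤ Submodule.span F (W ∩ P) →
      (∀ u ∈ W, u ∈ P → u * w - w * u ∈ P) → ∀ u ∈ P, u * w - w * u ∈ P := by
    intro P w hP h u hu
    refine Submodule.span_induction (p := fun u _ => u * w - w * u ∈ P) ?_ ?_ ?_ ?_ (hP hu)
    · exact fun u hu => h u hu.1 hu.2
    · simp
    · intro a b _ _ ha hb
      have : (a + b) * w - w * (a + b) = (a * w - w * a) + (b * w - w * b) := by noncomm_ring
      rw [this]; exact add_mem ha hb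
    · intro c a _ ha
      rw [smul_mul_assoc, mul_smul_comm, ← smul_sub]; exact P.smul_mem c ha
  -- `P` is required to be spanned by elements of `W` so that a bracket condition known only on `W ∩
  -- P` extends linearly to all of `P`.
  obtain ⟨P, ⟨hP1, hP2⟩, hmax⟩ := WellFounded.has_min
    (wellFounded_gt (α := Submodule F A))
    {P | P ≤ Submodule.span F (W ∩ P) ∧ IsNilpotent P} ⟨⊥, bot_le, ⟨1, pow_one _⟩⟩
  by_cases hWP : W ⊆ P
  · have : Submodule.span F W = P := le_antisymm (Submodule.span_le.2 hWP)
      (hP1.trans (Submodule.span_mono Set.inter_subset_left))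
    rwa [this]
  · exfalso
    obtain ⟨w, hw, hwP, h⟩ := exists_bracket_mem_of_isNilpotent hW hP2 hWP
    refine hmax (P ⊔ Submodule.span F {w}) ⟨?_, ?_⟩ ?_
    · refine sup_le (hP1.trans (Submodule.span_mono ?_)) (Submodule.span_mono ?_)
      · exact Set.inter_subset_inter_right _ (SetLike.coe_subset_coe.2 le_sup_left)
      · rintro _ rfl
        exact ⟨hw, Submodule.mem_sup_right (Submodule.mem_span_singleton_self _)⟩
    · exact isNilpotent_sup_span_singleton hP2 (hnil w hw) (hbr hP1 h)
    · exact left_lt_sup.2 fun hle => hwP (hle (Submodule.mem_span_singleton_self w))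

end Nil

/-! ### Common eigenvectors and simultaneous triangularization. -/

section Triangular

/-- A set of operators is simultaneously triangular as soon as every proper invariant subspace `U`
admits a common eigenvector modulo `U`. -/
theorem exists_basis_blockTriangular_of_forall_invariant {K V : Type*} [Field K] [AddCommGroup V]
    [Module K V] [FiniteDimensional K V] (T : Set (Module.End K V))
    (h : ∀ U : Submodule K V, (∀ t ∈ T, ∀ u ∈ U, t u ∈ U) → U ≠ ⊤ →
      ∃ v ∉ U, ∀ t ∈ T, t v ∈ Submodule.span K {v} ⊔ U) :
    ∃ (n : ℕ) (b : Module.Basis (Fin n) K V),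
      ∀ t ∈ T, (LinearMap.toMatrix b b t).BlockTriangular id := by
  have key : ∀ k ≤ Module.finrank K V, ∃ b : Fin k → V, LinearIndependent K b ∧
      ∀ t ∈ T, ∀ j, t (b j) ∈ Submodule.span K (b '' {i | i ≤ j}) := by
    intro k
    induction k with
    | zero => exact fun _ => ⟨Fin.elim0, linearIndependent_empty_type, fun t _ j => j.elim0⟩
    | succ k ih =>
      intro hk
      obtain ⟨b, hb, hbT⟩ := ih (by omega)
      obtain ⟨v, hv, hvT⟩ := h (Submodule.span K (Set.range b)) (by
        intro t ht u hu
        refine Submodule.span_induction (p := fun u _ => t u ∈ Submodule.span K (Set.range b))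
          ?_ ?_ ?_ ?_ hu
        · rintro _ ⟨j, rfl⟩
          exact Submodule.span_mono (Set.image_subset_range _ _) (hbT t ht j)
        · rw [map_zero]; exact Submodule.zero_mem _
        · intro x y _ _ hx hy; rw [map_add]; exact add_mem hx hy
        · intro c x _ hx; rw [map_smul]; exact Submodule.smul_mem _ c hx) (by
        intro htop
        have h1 := finrank_span_eq_card hb
        rw [htop, finrank_top, Fintype.card_fin] at h1
        omega)
      refine ⟨Fin.snoc b v, linearIndependent_finSnoc.2 ⟨hb, hv⟩, fun t ht j => ?_⟩
      induction j using Fin.lastCases with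
      | last =>
        rw [Fin.snoc_last]
        refine (show Submodule.span K {v} ⊔ Submodule.span K (Set.range b) ≤ _ from
          sup_le ?_ (Submodule.span_mono ?_)) (hvT t ht)
        · refine Submodule.span_mono (Set.singleton_subset_iff.2 ⟨Fin.last k, (le_refl _ : _ ≤ Fin.last k), ?_⟩)
          rw [Fin.snoc_last]
        · rintro _ ⟨i, rfl⟩
          exact ⟨i.castSucc, Fin.le_last _, by rw [Fin.snoc_castSucc]⟩
      | cast j =>
        rw [Fin.snoc_castSucc]
        refine Submodule.span_mono ?_ (hbT t ht j)
        rintro _ ⟨i, hi, rfl⟩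
        exact ⟨i.castSucc, Fin.castSucc_le_castSucc_iff.2 hi, by rw [Fin.snoc_castSucc]⟩
  obtain ⟨b, hb, hbT⟩ := key _ le_rfl
  refine ⟨_, Module.Basis.mk hb (hb.span_eq_top_of_card_eq_finrank' (by simp)).ge, ?_⟩
  intro t ht i j hij
  rw [LinearMap.toMatrix_apply]
  have h1 := hbT t ht j
  set B := Module.Basis.mk hb (hb.span_eq_top_of_card_eq_finrank' (by simp)).ge with hB
  have hBb : (B : _ → V) = b := Module.Basis.coe_mk _ _
  rw [← hBb, Module.Basis.mem_span_image] at h1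
  by_contra hne
  exact absurd (h1 (Finsupp.mem_support_iff.2 hne)) (not_le.2 hij)

variable {K E : Type*} [Field K] [NonUnitalNonAssocRing E] [Module K E]
  [SMulCommClass K E E] [IsLeibniz E]

theorem mul_mul_eq_sub (a b c : E) : (a * b) * c = a * (b * c) - b * (a * c) := by
  rw [IsLeibniz.leibniz a b c, add_sub_cancel_right]

theorem mulLeft_mul_eq_commutator (a b : E) : LinearMap.mulLeft K (a * b) =
    LinearMap.mulLeft K a * LinearMap.mulLeft K b -
      LinearMap.mulLeft K b * LinearMap.mulLeft K a := by
  ext c; exact mul_mul_eq_sub a b c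

/-- Jacobson's theorem for the left multiplications by products of elements of a multiplicatively
closed set. -/
theorem isNilpotent_span_mulLeft [FiniteDimensional K E] {S : Set E}
    (hS : ∀ a ∈ S, ∀ b ∈ S, a * b ∈ S)
    (hnil : ∀ a ∈ S, ∀ b ∈ S, IsNilpotent (LinearMap.mulLeft K (a * b))) :
    IsNilpotent (Submodule.span K {f : Module.End K E |
      ∃ a ∈ S, ∃ b ∈ S, f = LinearMap.mulLeft K (a * b)}) := by
  refine isNilpotent_span_of_forall_commutator_mem ?_ ?_
  · rintro _ ⟨a, ha, b, hb, rfl⟩ _ ⟨c, hc, d, hd, rfl⟩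
    exact ⟨a * b, hS a ha b hb, c * d, hS c hc d hd, (mulLeft_mul_eq_commutator _ _).symm⟩
  · rintro _ ⟨a, ha, b, hb, rfl⟩
    exact hnil a ha b hb

variable [IsScalarTower K E E]

/-- In a minimal `S`-stable `N` above `U`, right multiplications on `N / U` are determined by left
ones. Products act as zero there by Jacobson's theorem, so left multiplications commute, and by
minimality each is a scalar. Any vector of `N` outside `U` then works. -/
theorem exists_common_eigenvector_mod [IsAlgClosed K] [FiniteDimensional K E] {S : Set E}
    (hS : ∀ a ∈ S, ∀ b ∈ S, a * b ∈ S)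
    (hnil : ∀ a ∈ S, ∀ b ∈ S, IsNilpotent (LinearMap.mulLeft K (a * b)))
    {U : Submodule K E} (hU : U ≠ ⊤) (hUl : ∀ s ∈ S, ∀ u ∈ U, s * u ∈ U)
    (hUr : ∀ s ∈ S, ∀ u ∈ U, u * s ∈ U) :
    ∃ v ∉ U, ∀ s ∈ S, s * v ∈ Submodule.span K {v} ⊔ U ∧ v * s ∈ Submodule.span K {v} ⊔ U := by
  obtain ⟨N, ⟨hUN, hNl, hNr⟩, hmin⟩ := WellFounded.has_min
    (wellFounded_lt (α := Submodule K E))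
    {N | U < N ∧ (∀ s ∈ S, ∀ y ∈ N, s * y ∈ N) ∧ (∀ s ∈ S, ∀ y ∈ N, y * s ∈ N)}
    ⟨⊤, lt_top_iff_ne_top.2 hU, fun _ _ _ _ => trivial, fun _ _ _ _ => trivial⟩
  have hmin' : ∀ X : Submodule K E, U ≤ X → X ≤ N → (∀ s ∈ S, ∀ y ∈ X, s * y ∈ X) →
      (∀ s ∈ S, ∀ y ∈ X, y * s ∈ X) → (∃ x ∈ X, x ∉ U) → N ≤ X := by
    rintro X hUX hXN hl hr ⟨x, hx, hxU⟩
    have : ¬ X < N := hmin X ⟨lt_of_le_of_ne hUX (by rintro rfl; exact hxU hx), hl, hr⟩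
    exact (eq_or_lt_of_le hXN).elim (fun h => h.ge) (fun h => absurd h this)
  -- On the minimal factor, right multiplications vanish or are opposite to left multiplications.
  have hR : (∀ s ∈ S, ∀ y ∈ N, y * s ∈ U) ∨ (∀ s ∈ S, ∀ y ∈ N, y * s + s * y ∈ U) := by
    let X : Submodule K E :=
      { carrier := {y | y ∈ N ∧ ∀ s ∈ S, y * s ∈ U}
        add_mem' := fun hx hy => ⟨add_mem hx.1 hy.1, fun s hs => by
          rw [add_mul]; exact add_mem (hx.2 s hs) (hy.2 s hs)⟩
        zero_mem' := ⟨N.zero_mem, fun s _ => by rw [zero_mul]; exact U.zero_mem⟩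
        smul_mem' := fun c x hx => ⟨N.smul_mem c hx.1, fun s hs => by
          rw [smul_mul_assoc]; exact U.smul_mem c (hx.2 s hs)⟩ }
    by_cases hX : ∃ x ∈ X, x ∉ U
    · refine Or.inl fun s hs y hy => (hmin' X ?_ (fun y hy => hy.1) ?_ ?_ hX hy).2 s hs
      · exact fun u hu => ⟨hUN.le hu, fun s hs => hUr s hs u hu⟩
      · refine fun t ht y hy => ⟨hNl t ht y hy.1, fun s hs => ?_⟩
        rw [mul_mul_eq_sub]
        exact sub_mem (hUl t ht _ (hy.2 s hs)) (hy.2 _ (hS t ht s hs))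
      · exact fun t ht y hy => ⟨hNr t ht y hy.1, fun s hs => hUr s hs _ (hy.2 t ht)⟩
    · push Not at hX
      -- The Leibniz identity gives `(y * b + b * y) * c = 0`, so `y * b + b * y` lies in `X`, which
      -- here is contained in `U`.
      refine Or.inr fun b hb y hy => hX _ ⟨add_mem (hNr b hb y hy) (hNl b hb y hy), fun c _ => ?_⟩
      rw [add_mul, mul_mul_eq_sub, mul_mul_eq_sub, sub_add_sub_cancel, sub_self]
      exact U.zero_mem
  -- By `hR`, left-stable subspaces between `U` and `N` are automatically right-stable, so
  -- minimality can be tested with left multiplications alone.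
  have hmin'' : ∀ X : Submodule K E, U ≤ X → X ≤ N → (∀ s ∈ S, ∀ y ∈ X, s * y ∈ X) →
      (∃ x ∈ X, x ∉ U) → N ≤ X := by
    refine fun X hUX hXN hl hx => hmin' X hUX hXN hl (fun s hs y hy => ?_) hx
    rcases hR with h | h
    · exact hUX (h s hs y (hXN hy))
    · rw [← add_sub_cancel_right (y * s) (s * y)]
      exact sub_mem (hUX (h s hs y (hXN hy))) (hl s hs y hy)
  obtain ⟨y₀, hy₀N, hy₀U⟩ := SetLike.exists_of_lt hUN
  have hcomm : ∀ a ∈ S, ∀ b ∈ S, ∀ y ∈ N, (a * b) * y ∈ U := by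
    let X : Submodule K E :=
      { carrier := {y | y ∈ N ∧ ∀ a ∈ S, ∀ b ∈ S, (a * b) * y ∈ U}
        add_mem' := fun hx hy => ⟨add_mem hx.1 hy.1, fun a ha b hb => by
          rw [mul_add]; exact add_mem (hx.2 a ha b hb) (hy.2 a ha b hb)⟩
        zero_mem' := ⟨N.zero_mem, fun _ _ _ _ => by rw [mul_zero]; exact U.zero_mem⟩
        smul_mem' := fun c x hx => ⟨N.smul_mem c hx.1, fun a ha b hb => by
          rw [mul_smul_comm]; exact U.smul_mem c (hx.2 a ha b hb)⟩ }
    intro a ha b hb y hy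
    refine (hmin'' X ?_ (fun y hy => hy.1) ?_ ?_ hy).2 a ha b hb
    · exact fun u hu => ⟨hUN.le hu, fun a ha b hb => hUl _ (hS a ha b hb) u hu⟩
    · refine fun s hs y hy => ⟨hNl s hs y hy.1, fun a ha b hb => ?_⟩
      rw [IsLeibniz.leibniz]
      exact add_mem (hy.2 _ (hS a ha b hb) s hs) (hUl s hs _ (hy.2 a ha b hb))
    -- If no vector outside `U` were killed modulo `U` by all products, products of operators of any
    -- length could be applied to `y₀` without entering `U`, against the nilpotency of their span.
    · by_contra! hX
      obtain ⟨n, hn⟩ := isNilpotent_span_mulLeft (K := K) hS hnil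
      set P := Submodule.span K {f : Module.End K E |
        ∃ a ∈ S, ∃ b ∈ S, f = LinearMap.mulLeft K (a * b)}
      have key : ∀ k, ∃ q ∈ P ^ k, q y₀ ∈ N ∧ q y₀ ∉ U := by
        intro k
        induction k with
        | zero =>
          exact ⟨1, by rw [pow_zero]; exact Submodule.one_le.1 le_rfl, hy₀N, hy₀U⟩
        | succ k ih =>
          obtain ⟨q, hq, hqN, hqU⟩ := ih
          have h1 : ¬ ∀ a ∈ S, ∀ b ∈ S, (a * b) * q y₀ ∈ U := fun h => hqU (hX _ ⟨hqN, h⟩)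
          push Not at h1
          obtain ⟨a, ha, b, hb, hab⟩ := h1
          refine ⟨LinearMap.mulLeft K (a * b) * q, ?_, hNl _ (hS a ha b hb) _ hqN, hab⟩
          rw [pow_succ']
          exact Submodule.mul_mem_mul (Submodule.subset_span ⟨a, ha, b, hb, rfl⟩) hq
      obtain ⟨q, hq, -, hqU⟩ := key n
      rw [hn] at hq
      rw [(Submodule.mem_bot K).1 hq] at hqU
      exact hqU U.zero_mem
  have heig : ∀ s ∈ S, ∃ μ : K, ∀ y ∈ N, s * y - μ • y ∈ U := by
    intro s hs
    let f : Module.End K N := (LinearMap.mulLeft K s).restrict (hNl s hs)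
    let W : Submodule K N := U.comap N.subtype
    have hfW : W ≤ W.comap f := fun y hy => hUl s hs _ hy
    have : Nontrivial (N ⧸ W) := by
      refine Submodule.Quotient.nontrivial_iff.2 fun h => hy₀U ?_
      have h1 : (⟨y₀, hy₀N⟩ : N) ∈ W := h ▸ Submodule.mem_top
      exact h1
    obtain ⟨μ, hμ⟩ := Module.End.exists_eigenvalue (W.mapQ W f hfW)
    obtain ⟨v, hv⟩ := hμ.exists_hasEigenvector
    obtain ⟨v, rfl⟩ := Submodule.Quotient.mk_surjective _ v
    have hv1 : s * (v : E) - μ • (v : E) ∈ U := by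
      have h1 := hv.apply_eq_smul
      rw [Submodule.mapQ_apply, ← Submodule.Quotient.mk_smul, Submodule.Quotient.eq] at h1
      exact h1
    have hv2 : (v : E) ∉ U := fun h => hv.2 ((Submodule.Quotient.mk_eq_zero _).2 h)
    -- The `μ`-eigenspace of `s` modulo `U`: it is stable because left multiplications commute on `N
    -- / U`, hence it is all of `N`.
    let X : Submodule K E :=
      { carrier := {y | y ∈ N ∧ s * y - μ • y ∈ U}
        add_mem' := fun {x y} hx hy => ⟨add_mem hx.1 hy.1, by
          rw [mul_add, smul_add, add_sub_add_comm]; exact add_mem hx.2 hy.2⟩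
        zero_mem' := ⟨N.zero_mem, by rw [mul_zero, smul_zero, sub_zero]; exact U.zero_mem⟩
        smul_mem' := fun c x hx => ⟨N.smul_mem c hx.1, by
          rw [mul_smul_comm, smul_comm, ← smul_sub]; exact U.smul_mem c hx.2⟩ }
    refine ⟨μ, fun y hy => (hmin'' X ?_ (fun y hy => hy.1) ?_ ⟨v, ⟨v.2, hv1⟩, hv2⟩ hy).2⟩
    · exact fun u hu => ⟨hUN.le hu, sub_mem (hUl s hs u hu) (U.smul_mem μ hu)⟩
    · refine fun t ht y hy => ⟨hNl t ht y hy.1, ?_⟩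
      rw [IsLeibniz.leibniz, add_sub_assoc, ← mul_smul_comm, ← mul_sub]
      exact add_mem (hcomm s hs t ht y hy.1) (hUl t ht _ hy.2)
  refine ⟨y₀, hy₀U, fun s hs => ?_⟩
  have h1 : s * y₀ ∈ Submodule.span K {y₀} ⊔ U := by
    obtain ⟨μ, hμ⟩ := heig s hs
    rw [← sub_add_cancel (s * y₀) (μ • y₀)]
    exact add_mem (Submodule.mem_sup_right (hμ y₀ hy₀N)) (Submodule.mem_sup_left
      (Submodule.smul_mem _ _ (Submodule.mem_span_singleton_self _)))
  refine ⟨h1, ?_⟩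
  rcases hR with h | h
  · exact Submodule.mem_sup_right (h s hs _ hy₀N)
  · rw [← add_sub_cancel_right (y₀ * s) (s * y₀)]
    exact sub_mem (Submodule.mem_sup_right (h s hs _ hy₀N)) h1

theorem exists_basis_blockTriangular_mul [IsAlgClosed K] [FiniteDimensional K E] {S : Set E}
    (hS : ∀ a ∈ S, ∀ b ∈ S, a * b ∈ S)
    (hnil : ∀ a ∈ S, ∀ b ∈ S, IsNilpotent (LinearMap.mulLeft K (a * b))) :
    ∃ (n : ℕ) (b : Module.Basis (Fin n) K E), ∀ z ∈ Submodule.span K S,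
      (LinearMap.toMatrix b b (LinearMap.mulLeft K z)).BlockTriangular id ∧
      (LinearMap.toMatrix b b (LinearMap.mulRight K z)).BlockTriangular id := by
  obtain ⟨n, b, hb⟩ := exists_basis_blockTriangular_of_forall_invariant
    (LinearMap.mulLeft K '' S ∪ LinearMap.mulRight K '' S) (by
      intro U hU hUtop
      obtain ⟨v, hv, h⟩ := exists_common_eigenvector_mod (K := K) hS hnil hUtop
        (fun s hs u hu => hU _ (Or.inl ⟨s, hs, rfl⟩) u hu)
        (fun s hs u hu => hU _ (Or.inr ⟨s, hs, rfl⟩) u hu)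
      refine ⟨v, hv, ?_⟩
      rintro _ (⟨s, hs, rfl⟩ | ⟨s, hs, rfl⟩)
      exacts [(h s hs).1, (h s hs).2])
  refine ⟨n, b, fun z hz => ?_⟩
  refine Submodule.span_induction (p := fun z _ =>
    (LinearMap.toMatrix b b (LinearMap.mulLeft K z)).BlockTriangular id ∧
    (LinearMap.toMatrix b b (LinearMap.mulRight K z)).BlockTriangular id) ?_ ?_ ?_ ?_ hz
  · exact fun s hs => ⟨hb _ (Or.inl ⟨s, hs, rfl⟩), hb _ (Or.inr ⟨s, hs, rfl⟩)⟩
  · constructor <;> intro i j _ <;> simp [LinearMap.toMatrix_apply]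
  · intro x y _ _ hx hy
    constructor <;> intro i j hij
    · have h1 := hx.1 hij
      have h2 := hy.1 hij
      simp only [LinearMap.toMatrix_apply, LinearMap.mulLeft_apply] at h1 h2 ⊢
      rw [add_mul, map_add, Finsupp.add_apply, h1, h2, add_zero]
    · have h1 := hx.2 hij
      have h2 := hy.2 hij
      simp only [LinearMap.toMatrix_apply, LinearMap.mulRight_apply] at h1 h2 ⊢
      rw [mul_add, map_add, Finsupp.add_apply, h1, h2, add_zero]
  · intro c x _ hx
    constructor <;> intro i j hij
    · have h1 := hx.1 hij
      simp only [LinearMap.toMatrix_apply, LinearMap.mulLeft_apply] at h1 ⊢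
      rw [smul_mul_assoc, map_smul, Finsupp.smul_apply, h1, smul_zero]
    · have h1 := hx.2 hij
      simp only [LinearMap.toMatrix_apply, LinearMap.mulRight_apply] at h1 ⊢
      rw [mul_smul_comm, map_smul, Finsupp.smul_apply, h1, smul_zero]

end Triangular

/-! ### The two-element criterion for triangulability, and two-generation. -/

section Criterion

/-- The commutator is upper triangular with zero diagonal, so its characteristic polynomial is a
power of `X`, and Cayley–Hamilton applies. -/
theorem Matrix.BlockTriangular.isNilpotent_mul_sub_mul {R : Type*} [CommRing R] {n : ℕ}
    {A B : Matrix (Fin n) (Fin n) R} (hA : A.BlockTriangular id) (hB : B.BlockTriangular id) :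
    IsNilpotent (A * B - B * A) := by
  have hdiag : ∀ {A B : Matrix (Fin n) (Fin n) R}, A.BlockTriangular id → B.BlockTriangular id →
      ∀ i, (A * B) i i = A i i * B i i := by
    intro A B hA hB i
    rw [Matrix.mul_apply]
    refine Finset.sum_eq_single i (fun j _ hj => ?_) (fun h => absurd (Finset.mem_univ i) h)
    rcases lt_or_gt_of_ne hj with h | h
    · rw [hA h, zero_mul]
    · rw [hB h, mul_zero]
  have h1 := Matrix.charpoly_of_isUpperTriangular (A * B - B * A) ((hA.mul hB).sub (hB.mul hA))
  have h2 := Matrix.aeval_self_charpoly (A * B - B * A)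
  simp only [Matrix.sub_apply, hdiag hA hB, hdiag hB hA, mul_comm, sub_self, map_zero, sub_zero,
    Finset.prod_const] at h1
  rw [h1, map_pow, Polynomial.aeval_X] at h2
  exact ⟨_, h2⟩

variable {F : Type u} {L : Type v} [Field F] [NonUnitalNonAssocRing L] [Module F L]
  [IsScalarTower F L L] [SMulCommClass F L L]

theorem baseChange_mulLeft (K : Type*) [Field K] [Algebra F K] (x : L) :
    (LinearMap.mulLeft F x).baseChange K = LinearMap.mulLeft K ((1 : K) ⊗ₜ[F] x) := by
  ext y
  simp

variable [IsLeibniz L]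

instance (K : Type*) [Field K] [Algebra F K] : IsLeibniz (K ⊗[F] L) where
  leibniz a b c := by
    induction a with
    | zero => simp
    | add a a' ha ha' => simp only [add_mul, mul_add, ha, ha']; abel
    | tmul r a =>
      induction b with
      | zero => simp
      | add b b' hb hb' => simp only [add_mul, mul_add, hb, hb']; abel
      | tmul s b =>
        induction c with
        | zero => simp
        | add c c' hc hc' => simp only [mul_add, hc, hc']; abel
        | tmul t c =>
          simp only [Algebra.TensorProduct.tmul_mul_tmul]
          rw [IsLeibniz.leibniz a b c, TensorProduct.tmul_add, mul_assoc, mul_left_comm s r t]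

variable [FiniteDimensional F L]

/-- A subalgebra is triangulable on `L` if and only if all products of two of its elements act
nilpotently on `L` by left multiplication. -/
theorem isTriangulableOn_iff {S : NonUnitalSubalgebra F L} :
    IsTriangulableOn S ↔ ∀ a ∈ S, ∀ b ∈ S, IsNilpotent (LinearMap.mulLeft F (a * b)) := by
  have hinj : Function.Injective
      (Module.End.baseChangeHom F (AlgebraicClosure F) L) := by
    refine (injective_iff_map_eq_zero _).2 fun f hf => LinearMap.ext fun x => ?_
    have h1 := LinearMap.congr_fun hf (1 ⊗ₜ x)
    change (1 : AlgebraicClosure F) ⊗ₜ[F] f x = 0 at h1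
    exact (Module.FaithfullyFlat.one_tmul_eq_zero_iff F L _).1 h1
  have hbc : ∀ x : L, Module.End.baseChangeHom F (AlgebraicClosure F) L (LinearMap.mulLeft F x) =
      LinearMap.mulLeft (AlgebraicClosure F) ((1 : AlgebraicClosure F) ⊗ₜ[F] x) :=
    baseChange_mulLeft _
  have hmul : ∀ a b : L, (1 : AlgebraicClosure F) ⊗ₜ[F] (a * b) = (1 ⊗ₜ a) * (1 ⊗ₜ b) := by
    intro a b; rw [Algebra.TensorProduct.tmul_mul_tmul, mul_one]
  constructor
  · rintro ⟨n, b, hb⟩ x hx y hy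
    rw [← IsNilpotent.map_iff hinj, hbc, hmul, mulLeft_mul_eq_commutator]
    have h1 := (hb _ (Submodule.tmul_mem_baseChange_of_mem 1 hx)).1.isNilpotent_mul_sub_mul
      (hb _ (Submodule.tmul_mem_baseChange_of_mem 1 hy)).1
    rw [← LinearMap.toMatrix_mul, ← LinearMap.toMatrix_mul, ← map_sub] at h1
    exact (IsNilpotent.map_iff (LinearMap.toMatrixAlgEquiv b).injective).1 h1
  · intro h
    -- Nilpotency is known only for products of pure tensors `1 ⊗ₜ x`. This set is multiplicatively
    -- closed and spans the base change, which is why the triangularization is stated for sets and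
    -- their spans.
    obtain ⟨n, b, hb⟩ := exists_basis_blockTriangular_mul (K := AlgebraicClosure F)
      (S := TensorProduct.mk F (AlgebraicClosure F) L 1 '' (S : Set L)) (by
        rintro _ ⟨x, hx, rfl⟩ _ ⟨y, hy, rfl⟩
        exact ⟨x * y, mul_mem hx hy, hmul x y⟩) (by
        rintro _ ⟨x, hx, rfl⟩ _ ⟨y, hy, rfl⟩
        rw [TensorProduct.mk_apply, TensorProduct.mk_apply, ← hmul, ← hbc]
        exact (h x hx y hy).map _)
    refine ⟨n, b, fun z hz => hb z ?_⟩
    rw [Submodule.baseChange_eq_span] at hz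
    exact hz

theorem IsTwoGenerated.of_isMinimallyNonTriangulable (hL : IsMinimallyNonTriangulable F L) :
    IsTwoGenerated F L := by
  by_contra h
  refine hL.2 (isTriangulableOn_iff.2 fun a _ b _ => ?_)
  have hne : NonUnitalAlgebra.adjoin F ({a, b} : Set L) ≠ ⊤ := fun h' => h ⟨a, b, h'⟩
  exact isTriangulableOn_iff.1 (hL.1 _ hne) a (NonUnitalAlgebra.subset_adjoin F (by simp))
    b (NonUnitalAlgebra.subset_adjoin F (by simp))

end Criterion

/-! ### Triangulable subalgebras are solvable. -/

section Solvable

variable {F : Type u} {L : Type v} [Field F] [NonUnitalNonAssocRing L] [Module F L]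
  [IsScalarTower F L L] [SMulCommClass F L L]

/-- The linear span of all products of two elements of a subspace. -/
def Submodule.square (X : Submodule F L) : Submodule F L :=
  Submodule.map₂ (LinearMap.mul F L) X X

/-- The derived series of a subspace. -/
def Submodule.derived (X : Submodule F L) : ℕ → Submodule F L
  | 0 => X
  | k + 1 => (Submodule.derived X k).square

namespace Submodule

theorem mul_mem_square {X : Submodule F L} {a b : L} (ha : a ∈ X) (hb : b ∈ X) :
    a * b ∈ X.square := apply_mem_map₂ (LinearMap.mul F L) ha hb

theorem square_le {X Y : Submodule F L} : X.square ≤ Y ↔ ∀ a ∈ X, ∀ b ∈ X, a * b ∈ Y :=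
  map₂_le

theorem square_mono {X Y : Submodule F L} (h : X ≤ Y) : X.square ≤ Y.square :=
  square_le.2 fun _ ha _ hb => mul_mem_square (h ha) (h hb)

theorem derived_succ_eq_derived_square (X : Submodule F L) (k : ℕ) :
    X.derived (k + 1) = X.square.derived k := by
  induction k with
  | zero => rfl
  | succ k ih => rw [derived, ih, derived]

theorem derived_succ_le_square {S : Submodule F L} (hS : ∀ a ∈ S, ∀ b ∈ S, a * b ∈ S) (k : ℕ) :
    S.derived (k + 1) ≤ S.square := by
  have h : ∀ k, S.derived k ≤ S := by
    intro k
    induction k with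
    | zero => exact le_rfl
    | succ k ih => exact square_le.2 fun a ha b hb => hS a (ih ha) b (ih hb)
  exact square_mono (h k)

end Submodule

/-- The span of all left multiplications by products of elements of `S`. -/
def mulLeftSquare (S : NonUnitalSubalgebra F L) : Submodule F (Module.End F L) :=
  Submodule.span F {f : Module.End F L | ∃ a ∈ (S : Set L), ∃ b ∈ (S : Set L),
    f = LinearMap.mulLeft F (a * b)}

theorem mulLeft_mem_mulLeftSquare {S : NonUnitalSubalgebra F L} {x : L}
    (hx : x ∈ S.toSubmodule.square) : LinearMap.mulLeft F x ∈ mulLeftSquare S := by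
  have h : S.toSubmodule.square ≤ (mulLeftSquare S).comap (LinearMap.mul F L) :=
    Submodule.square_le.2 fun a ha b hb => Submodule.subset_span ⟨a, ha, b, hb, rfl⟩
  exact h hx

variable [IsLeibniz L] [FiniteDimensional F L]

namespace IsTriangulableOn

variable {S : NonUnitalSubalgebra F L}

theorem isNilpotent_mulLeftSquare (hS : IsTriangulableOn S) : IsNilpotent (mulLeftSquare S) :=
  isNilpotent_span_mulLeft (fun _ ha _ hb => mul_mem ha hb) (isTriangulableOn_iff.1 hS)

/-- An element of `S²` is only a sum of products, and sums of nilpotents need not be nilpotent;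
nilpotency of the whole span is what is used. -/
theorem isNilpotent_mulLeft (hS : IsTriangulableOn S) {x : L} (hx : x ∈ S.toSubmodule.square) :
    IsNilpotent (LinearMap.mulLeft F x) := by
  obtain ⟨n, hn⟩ := hS.isNilpotent_mulLeftSquare
  refine ⟨n, ?_⟩
  have h := Submodule.pow_mem_pow _ (mulLeft_mem_mulLeftSquare hx) n
  rw [hn] at h
  exact (Submodule.mem_bot F).1 h

theorem exists_derived_eq_bot (hS : IsTriangulableOn S) :
    ∃ k, S.toSubmodule.derived k = ⊥ := by
  obtain ⟨n, hn⟩ := hS.isNilpotent_mulLeftSquare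
  -- For `a`, `b` in the derived term of index `j + 1`, `q (a * b) = (q * mulLeft a) b`, and `a ∈
  -- S²`: one derived step is traded for one more factor from `mulLeftSquare S`. Taking `i = 0`, `q
  -- = 1` ends the argument.
  have key : ∀ j i, n ≤ i + j → ∀ q ∈ mulLeftSquare S ^ i,
      S.toSubmodule.derived (j + 1) ≤ LinearMap.ker q := by
    intro j
    induction j with
    | zero =>
      intro i hi q hq x _
      rw [pow_eq_zero_of_le (by omega) hn] at hq
      rw [(Submodule.mem_bot F).1 hq]
      rfl
    | succ j ih =>
      intro i hi q hq
      refine Submodule.square_le.2 fun a ha b hb => ?_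
      refine ih (i + 1) (by omega) (q * LinearMap.mulLeft F a) ?_ hb
      rw [pow_succ]
      exact Submodule.mul_mem_mul hq (mulLeft_mem_mulLeftSquare
        (Submodule.derived_succ_le_square (fun a ha b hb => S.mul_mem ha hb) j ha))
  refine ⟨n + 1, eq_bot_iff.2 ?_⟩
  have h := key n 0 (by omega) 1 (by rw [pow_zero]; exact Submodule.one_le.1 le_rfl)
  exact fun x hx => h hx

end IsTriangulableOn

end Solvable

/-! ### The Fitting null component of a left multiplication. -/

section Fitting

variable {F : Type u} {L : Type v} [Field F] [NonUnitalNonAssocRing L] [Module F L]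
  [SMulCommClass F L L] [IsLeibniz L]

/-- Left multiplication by `x` is a derivation, so its `n`-th power on `a * b` expands by the
Leibniz rule with `p` applications to `a` and `n - p` to `b`. As `i + j ≤ n + 1`, each term has `p ≥
i` or `n - p ≥ j`. -/
theorem mulLeft_pow_mul_eq_zero (x : L) (n : ℕ) : ∀ (i j : ℕ) (a b : L),
    (LinearMap.mulLeft F x ^ i) a = 0 → (LinearMap.mulLeft F x ^ j) b = 0 → i + j ≤ n + 1 →
    (LinearMap.mulLeft F x ^ n) (a * b) = 0 := by
  induction n with
  | zero =>
    intro i j a b ha hb hij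
    rcases (by omega : i = 0 ∨ j = 0) with rfl | rfl
    · rw [pow_zero, Module.End.one_apply] at ha
      rw [ha, zero_mul, map_zero]
    · rw [pow_zero, Module.End.one_apply] at hb
      rw [hb, mul_zero, map_zero]
  | succ n ih =>
    intro i j a b ha hb hij
    rcases i with _ | i
    · rw [pow_zero, Module.End.one_apply] at ha
      rw [ha, zero_mul, map_zero]
    rcases j with _ | j
    · rw [pow_zero, Module.End.one_apply] at hb
      rw [hb, mul_zero, map_zero]
    rw [pow_succ, Module.End.mul_apply, LinearMap.mulLeft_apply, IsLeibniz.leibniz, map_add,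
      ih i (j + 1) (x * a) b (by rwa [pow_succ] at ha) hb (by omega),
      ih (i + 1) j a (x * b) ha (by rwa [pow_succ] at hb) (by omega), add_zero]

/-- The Fitting null component of a left multiplication is a subalgebra. -/
def fittingNull (F : Type u) {L : Type v} [Field F] [NonUnitalNonAssocRing L] [Module F L]
    [SMulCommClass F L L] [IsLeibniz L] (x : L) : NonUnitalSubalgebra F L where
  carrier := {v | ∃ n, (LinearMap.mulLeft F x ^ n) v = 0}
  add_mem' := by
    rintro a b ⟨i, hi⟩ ⟨j, hj⟩
    refine ⟨i + j, ?_⟩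
    rw [map_add, Module.End.pow_map_zero_of_le (by omega) hi,
      Module.End.pow_map_zero_of_le (by omega) hj, add_zero]
  zero_mem' := ⟨0, map_zero _⟩
  smul_mem' := by
    rintro c a ⟨i, hi⟩
    exact ⟨i, by rw [map_smul, hi, smul_zero]⟩
  mul_mem' := by
    rintro a b ⟨i, hi⟩ ⟨j, hj⟩
    exact ⟨i + j, mulLeft_pow_mul_eq_zero x _ i j a b hi hj (by omega)⟩

variable [FiniteDimensional F L]

/-- High powers of `mulLeft x` have range inside `J`, and for large exponents kernel and range
together span `L`. -/
theorem fittingNull_sup_eq_top {x : L} {J : Submodule F L} {N : ℕ}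
    (hN : ∀ v, (LinearMap.mulLeft F x ^ N) v ∈ J) : (fittingNull F x).toSubmodule ⊔ J = ⊤ := by
  obtain ⟨n, hn⟩ :=
    Filter.eventually_atTop.1 (LinearMap.mulLeft F x).eventually_codisjoint_ker_pow_range_pow
  have h := (hn (n + N) (by omega)).eq_top
  rw [eq_top_iff, ← h]
  refine sup_le_sup (fun v hv => ⟨n + N, hv⟩) ?_
  rintro _ ⟨w, rfl⟩
  rw [add_comm, pow_add]
  exact hN _

variable [IsScalarTower F L L]

theorem isNilpotent_mulLeft_of_fittingNull_eq_top {x : L} (h : fittingNull F x = ⊤) :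
    IsNilpotent (LinearMap.mulLeft F x) := by
  rw [Module.End.isNilpotent_iff_of_finite]
  intro m
  have hm : m ∈ fittingNull F x := h ▸ NonUnitalAlgebra.mem_top
  exact hm

end Fitting

/-! ### Perfectness of `L` and simplicity of the Frattini quotient. -/

section Main

variable {F : Type u} {L : Type v} [Field F] [NonUnitalNonAssocRing L] [Module F L]
  [IsScalarTower F L L] [SMulCommClass F L L]

/-- If `J` is a two-sided ideal, `(X + J)² ≤ X² + J`. -/
theorem Submodule.square_sup_le {X J : Submodule F L} (hl : ∀ x : L, ∀ y ∈ J, x * y ∈ J)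
    (hr : ∀ x : L, ∀ y ∈ J, y * x ∈ J) : (X ⊔ J).square ≤ X.square ⊔ J := by
  refine Submodule.square_le.2 fun a ha b hb => ?_
  obtain ⟨x, hx, y, hy, rfl⟩ := Submodule.mem_sup.1 ha
  rw [add_mul]
  refine add_mem ?_ (Submodule.mem_sup_right (hr b y hy))
  obtain ⟨z, hz, w, hw, rfl⟩ := Submodule.mem_sup.1 hb
  rw [mul_add]
  exact add_mem (Submodule.mem_sup_left (Submodule.mul_mem_square hx hz))
    (Submodule.mem_sup_right (hl x w hw))

variable [IsLeibniz L]

theorem Submodule.mul_mem_derived_top (k : ℕ) : ∀ x : L, ∀ y ∈ (⊤ : Submodule F L).derived k,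
    x * y ∈ (⊤ : Submodule F L).derived k ∧ y * x ∈ (⊤ : Submodule F L).derived k := by
  induction k with
  | zero => exact fun _ _ _ => ⟨trivial, trivial⟩
  | succ k ih =>
    intro x y hy
    set D := (⊤ : Submodule F L).derived k
    have h : D.square ≤ D.square.comap (LinearMap.mulLeft F x) ⊓
        D.square.comap (LinearMap.mulRight F x) := by
      refine Submodule.square_le.2 fun a ha b hb => ⟨?_, ?_⟩
      · change x * (a * b) ∈ D.square
        rw [IsLeibniz.leibniz]
        exact add_mem (Submodule.mul_mem_square (ih x a ha).1 hb)
          (Submodule.mul_mem_square ha (ih x b hb).1)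
      · change (a * b) * x ∈ D.square
        rw [mul_mul_eq_sub]
        exact sub_mem (Submodule.mul_mem_square ha (ih x b hb).2)
          (Submodule.mul_mem_square hb (ih x a ha).2)
    exact h hy

variable [FiniteDimensional F L]

namespace IsMinimallyNonTriangulable

/-- If every proper subalgebra is triangulable, products act nilpotently modulo each term of the
derived series. -/
theorem exists_pow_mem_derived (hL : IsMinimallyNonTriangulable F L) (k : ℕ) :
    ∀ x ∈ (⊤ : Submodule F L).square, ∃ n, ∀ v,
      (LinearMap.mulLeft F x ^ n) v ∈ (⊤ : Submodule F L).derived k := by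
  induction k with
  | zero => exact fun _ _ => ⟨0, fun _ => trivial⟩
  | succ k ih =>
    intro x hx
    by_cases htop : fittingNull F x = ⊤
    · obtain ⟨n, hn⟩ := isNilpotent_mulLeft_of_fittingNull_eq_top htop
      exact ⟨n, fun v => by rw [hn]; exact Submodule.zero_mem _⟩
    obtain ⟨n, hn⟩ := ih x hx
    have hideal := Submodule.mul_mem_derived_top (F := F) (L := L) k
    set J := (⊤ : Submodule F L).derived k
    -- Here `L` is the sum of the null component and `J`, so `x ∈ L²` splits as `b + j` with `b` in
    -- the square of a proper, hence triangulable, subalgebra and `j ∈ J`.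
    have hx' := Submodule.square_sup_le (X := (fittingNull F x).toSubmodule)
      (fun y z hz => (hideal y z hz).1) (fun y z hz => (hideal y z hz).2)
      (fittingNull_sup_eq_top hn ▸ hx)
    obtain ⟨b, hb, j, hj, rfl⟩ := Submodule.mem_sup.1 hx'
    obtain ⟨m, hm⟩ := (hL.1 _ htop).isNilpotent_mulLeft hb
    -- Since `j * J ⊆ J²`, left multiplications by `b + j` and by the nilpotent `b` agree on `J`
    -- modulo `J²`, the next derived term.
    have key : ∀ i, ∀ v ∈ J, (LinearMap.mulLeft F (b + j) ^ i) v ∈ J ∧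
        (LinearMap.mulLeft F (b + j) ^ i) v - (LinearMap.mulLeft F b ^ i) v ∈ J.square := by
      intro i v hv
      induction i with
      | zero => exact ⟨hv, by simp⟩
      | succ i ihi =>
        obtain ⟨h1, h2⟩ := ihi
        simp only [pow_succ', Module.End.mul_apply, LinearMap.mulLeft_apply]
        refine ⟨(hideal _ _ h1).1, ?_⟩
        rw [add_mul, add_sub_right_comm, ← mul_sub]
        exact add_mem (Submodule.mul_mem_derived_top (k + 1) b _ h2).1
          (Submodule.mul_mem_square hj h1)
    refine ⟨m + n, fun v => ?_⟩
    have h := (key m _ (hn v)).2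
    rw [hm, LinearMap.zero_apply, sub_zero] at h
    rw [pow_add]
    exact h

/-- If `L²` is proper it is triangulable, hence solvable, and so is `L`. Products, nilpotent modulo
every derived term, are then nilpotent, making `L` triangulable. -/
theorem square_top_eq_top (hL : IsMinimallyNonTriangulable F L) :
    (⊤ : Submodule F L).square = ⊤ := by
  by_contra hne
  let S : NonUnitalSubalgebra F L :=
    { (⊤ : Submodule F L).square with
      mul_mem' := fun _ _ => Submodule.mul_mem_square trivial trivial }
  have hS : S ≠ ⊤ := fun h => hne (eq_top_iff.2 fun x _ =>
    (h ▸ NonUnitalAlgebra.mem_top : x ∈ S))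
  obtain ⟨k, hk⟩ := (hL.1 S hS).exists_derived_eq_bot
  have hk' : (⊤ : Submodule F L).derived (k + 1) = ⊥ := by
    rw [Submodule.derived_succ_eq_derived_square]; exact hk
  refine hL.2 (isTriangulableOn_iff.2 fun a _ b _ => ?_)
  obtain ⟨n, hn⟩ := hL.exists_pow_mem_derived (k + 1) (a * b)
    (Submodule.mul_mem_square trivial trivial)
  rw [hk'] at hn
  exact ⟨n, LinearMap.ext fun v => (Submodule.mem_bot F).1 (hn v)⟩

theorem ideal_le_of_isCoatom (hL : IsMinimallyNonTriangulable F L) {I : LeibnizIdeal F L}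
    (hI : I.toSubmodule ≠ ⊤) {M : NonUnitalSubalgebra F L} (hM : IsCoatom M) :
    I.toSubmodule ≤ M.toSubmodule := by
  have hl : ∀ x : L, ∀ y ∈ I.toSubmodule, x * y ∈ I.toSubmodule := fun x _ => I.mul_mem_left x
  have hr : ∀ x : L, ∀ y ∈ I.toSubmodule, y * x ∈ I.toSubmodule := fun x _ => I.mul_mem_right x
  by_contra hIM
  have hMM : M.toSubmodule.square ≤ M.toSubmodule :=
    Submodule.square_le.2 fun _ hx _ hy => M.mul_mem hx hy
  let S : NonUnitalSubalgebra F L :=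
    { M.toSubmodule ⊔ I.toSubmodule with
      mul_mem' := fun ha hb => (show M.toSubmodule.square ⊔ I.toSubmodule ≤ _ from
        sup_le_sup_right hMM _) (Submodule.square_sup_le hl hr (Submodule.mul_mem_square ha hb)) }
  have hMS : M ≤ S := fun x hx => (le_sup_left : M.toSubmodule ≤ M.toSubmodule ⊔ I.toSubmodule) hx
  have hS : S = ⊤ := hM.2 S (lt_of_le_not_ge hMS fun h => hIM fun x hx =>
    h ((le_sup_right : I.toSubmodule ≤ M.toSubmodule ⊔ I.toSubmodule) hx))
  have htop : M.toSubmodule ⊔ I.toSubmodule = ⊤ := eq_top_iff.2 fun x _ =>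
    (hS ▸ NonUnitalAlgebra.mem_top : x ∈ S)
  -- Perfectness of `L` propagates `M + I = L` along the derived series of `M`, which reaches zero
  -- because `M` is triangulable.
  have key : ∀ k, M.toSubmodule.derived k ⊔ I.toSubmodule = ⊤ := by
    intro k
    induction k with
    | zero => exact htop
    | succ k ih =>
      rw [eq_top_iff]
      calc ⊤ = (M.toSubmodule.derived k ⊔ I.toSubmodule).square := by
            rw [ih, hL.square_top_eq_top]
        _ ≤ _ := Submodule.square_sup_le hl hr
  obtain ⟨k, hk⟩ := (hL.1 M hM.1).exists_derived_eq_bot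
  have h := key k
  rw [hk, bot_sup_eq] at h
  exact hI h

/-- Only the absence of maximal subalgebras could make it all of `L`; by finite dimension that means
`L = 0`, which is triangulable. -/
theorem frattiniIdeal_ne_top (hL : IsMinimallyNonTriangulable F L) :
    (frattiniIdeal F L).toSubmodule ≠ ⊤ := by
  intro h
  have hmono : StrictMono (NonUnitalSubalgebra.toSubmodule : NonUnitalSubalgebra F L → _) :=
    fun _ _ h => h
  have : WellFoundedGT (NonUnitalSubalgebra F L) := hmono.wellFoundedGT
  rcases eq_top_or_exists_le_coatom (⊥ : NonUnitalSubalgebra F L) with hb | ⟨M, hM, -⟩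
  · refine hL.2 (isTriangulableOn_iff.2 fun a _ b _ => ⟨1, LinearMap.ext fun v => ?_⟩)
    have hv : ∀ v : L, v = 0 := fun v =>
      NonUnitalAlgebra.mem_bot.1 (hb ▸ NonUnitalAlgebra.mem_top : v ∈ _)
    exact hv _
  · refine hM.1 (eq_top_iff.2 fun x _ => ?_)
    have h1 := (frattiniIdeal_isGreatest F L).1 (h ▸ Submodule.mem_top : x ∈ _)
    exact (sInf_le hM : frattiniSubalgebra F L ≤ M) h1

theorem isSimpleLeibniz_quotient (hL : IsMinimallyNonTriangulable F L) :
    IsSimpleLeibniz F (frattiniIdeal F L).Quotient := by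
  set φ := frattiniIdeal F L with hφ
  constructor
  · by_contra! h
    refine hL.frattiniIdeal_ne_top (eq_top_iff.2 ?_)
    rw [← hL.square_top_eq_top]
    refine Submodule.square_le.2 fun a _ b _ => ?_
    rw [← Submodule.Quotient.mk_eq_zero, LeibnizIdeal.Quotient.mk_mul]
    exact h _ _
  · intro I
    let I' : LeibnizIdeal F L :=
      { I.toSubmodule.comap φ.toSubmodule.mkQ with
        mul_mem_left := fun x _ hy => I.mul_mem_left (Submodule.Quotient.mk x) hy
        mul_mem_right := fun x _ hy => I.mul_mem_right (Submodule.Quotient.mk x) hy }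
    have hmem : ∀ x : L, x ∈ I'.toSubmodule ↔
        (Submodule.Quotient.mk x : φ.Quotient) ∈ I.toSubmodule := fun _ => Iff.rfl
    by_cases hI : I'.toSubmodule = ⊤
    · right
      rw [eq_top_iff]
      rintro ⟨x⟩ -
      exact (hmem x).1 (hI ▸ Submodule.mem_top)
    · left
      -- The preimage of a proper ideal is proper, so it lies in every maximal subalgebra and
      -- therefore in `φ`.
      have h1 : I'.toSubmodule ≤ (frattiniSubalgebra F L).toSubmodule := by
        intro x hx
        refine NonUnitalAlgebra.mem_sInf.2 fun M hM => ?_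
        exact hL.ideal_le_of_isCoatom hI hM hx
      have h2 := (frattiniIdeal_isGreatest F L).2 I' h1
      rw [eq_bot_iff]
      rintro ⟨x⟩ hx
      exact (Submodule.mem_bot F).2 ((Submodule.Quotient.mk_eq_zero _).2 (h2 ((hmem x).2 hx)))

end IsMinimallyNonTriangulable

end Main

theorem mainTheorem6 {F : Type*} {L : Type*} [Field F] [NonUnitalNonAssocRing L] [Module F L]
    [IsScalarTower F L L] [SMulCommClass F L L] [IsLeibniz L] [FiniteDimensional F L]
    (hL : IsMinimallyNonTriangulable F L) :
    IsTwoGenerated F L ∧ IsSimpleLeibniz F (frattiniIdeal F L).Quotient :=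
  ⟨IsTwoGenerated.of_isMinimallyNonTriangulable hL, hL.isSimpleLeibniz_quotient⟩
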